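/- Let $H\in(0,1)$, $\alpha_0\in(-\pi/2,\pi/2)$ and $\delta>0$. Let $X=\{X(x)\}_{x\in\mathbb{R}^2}$ be the elementary field with parameters $(H,\alpha_0,\delta)$, that is, the centered real Gaussian random field with the harmonizable representation $X(x)=\int_{\mathbb{R}^2}(e^{i\langle x,\xi\rangle}-1)f(\xi)^{1/2}\,\widehat W(d\xi)$ ($\widehat W$ a complex-valued white noise), whose law is given by the covariance $$\mathbb{E}[X(x)X(y)]=\int_{\mathbb{R}^2}\bigl(e^{i\langle x,\xi\rangle}-1\bigr)\bigl(e^{-i\langle y,\xi\rangle}-1\bigr)f(\xi)\,d\xi,\qquad f(\xi)=\|\xi\|^{-2H-2}\,S\!\left(\frac{\xi}{\|\xi\|}\right),\qquad S(\Theta)=\frac1{2\delta}\mathbf 1_{[-\delta,\delta]}(\arg\Theta-\alpha_0),$$ where angles of directions are understood modulo $\pi$, so that $f$ is even: $S(\Theta)=1/(2\delta)$ if $|\arg\Theta-\alpha_0-k\pi|\le\delta$ for some $k\in\mathbb{Z}$, and $S(\Theta)=0$ otherwise. Let $\Phi:\mathbb{R}^2\to\mathbb{R}^2$ be continuously differentiable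 and let $Z(x)=X(\Phi(x))$, $x\in\mathbb{R}^2$, be the warped field. Then, for every $x_0\in\mathbb{R}^2$, the field $Z$ is $H$-localizable at $x_0$ with tangent field $$Y_{x_0}(x)=X\bigl(D\Phi(x_0)\,x\bigr),\qquad x\in\mathbb{R}^2,$$ where $D\Phi(x_0)$ is the Jacobian matrix of $\Phi$ at $x_0$. That is, as $\rho\to0^+$, $$\left\{\frac{Z(x_0+\rho h)-Z(x_0)}{\rho^{H}}\right\}_{h\in\mathbb{R}^2}\ \overset{d}{\longrightarrow}\ \{Y_{x_0}(h)\}_{h\in\mathbb{R}^2}$$ in the sense of weak convergence of stochastic processes: these fields have versions with continuous sample paths, and the laws of these versions on the space $C(\mathbb{R}^2,\mathbb{R})$, with the topology of uniform convergence on compact sets, converge weakly. -/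

import Mathlib

open MeasureTheory ProbabilityTheory Filter Topology

noncomputable section

/-- The Euclidean plane `ℝ²`. -/
abbrev Plane : Type := EuclideanSpace ℝ (Fin 2)

/-- The space `C(ℝ², ℝ)` of continuous functions carries the topology of uniform convergence on
compact sets (the compact-open topology); we equip it with its Borel σ-algebra. -/
instance instMeasurableSpaceContinuousPlane : MeasurableSpace C(Plane, ℝ) := borel _

instance instBorelSpaceContinuousPlane : BorelSpace C(Plane, ℝ) := ⟨rfl⟩

/-- The polar angle of a vector of the plane, in `(-π, π]`. -/
def planeArg (ξ : Plane) : ℝ := Complex.arg ⟨ξ 0, ξ 1⟩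

open Classical in
/-- The anisotropy function of the elementary field: `Θ ↦ (2δ)⁻¹ 1_{[-δ, δ]}(arg Θ - α₀)`.
Spectral densities of real fields are even, so angles of directions are understood modulo `π`
(`Θ` and `-Θ` span the same line). -/
def elementaryAnisotropy (α₀ δ : ℝ) (Θ : Plane) : ℝ :=
  if ∃ k : ℤ, planeArg Θ - α₀ - k * Real.pi ∈ Set.Icc (-δ) δ then 1 / (2 * δ) else 0

/-- The spectral density `ξ ↦ ‖ξ‖^{-2H-2} S(ξ / ‖ξ‖)` of the elementary field. -/
def elementaryDensity (H α₀ δ : ℝ) (ξ : Plane) : ℝ :=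
  ‖ξ‖ ^ (-2 * H - 2) * elementaryAnisotropy α₀ δ (‖ξ‖⁻¹ • ξ)

/-- The kernel `ξ ↦ e^{i⟨x, ξ⟩} - 1` of the harmonizable representation. -/
def harmonizableKernel (x ξ : Plane) : ℂ :=
  Complex.exp (Complex.I * (inner ℝ x ξ : ℝ)) - 1

/-- `X` is a centered real Gaussian field with the law of the harmonizable stochastic integral
`x ↦ ∫ (e^{i⟨x, ξ⟩} - 1) f(ξ)^{1/2} dŴ(ξ)`, that is, with covariance
`E[X(x) X(y)] = ∫ (e^{i⟨x, ξ⟩} - 1) (e^{-i⟨y, ξ⟩} - 1) f(ξ) dξ`. -/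
structure IsHarmonizableField {Ω : Type*} [MeasurableSpace Ω] (P : Measure Ω)
    (f : Plane → ℝ) (X : Plane → Ω → ℝ) : Prop where
  gaussian : IsGaussianProcess X P
  centered : ∀ x, ∫ ω, X x ω ∂P = 0
  covariance : ∀ x y, ((∫ ω, X x ω * X y ω ∂P : ℝ) : ℂ) =
    ∫ ξ, harmonizableKernel x ξ * (starRingEnd ℂ) (harmonizableKernel y ξ) * (f ξ : ℂ)

/-- `X` is an elementary field with self-similarity index `H`, orientation `α₀` and
accuracy `δ`. -/
def IsElementaryField {Ω : Type*} [MeasurableSpace Ω] (P : Measure Ω)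
    (H α₀ δ : ℝ) (X : Plane → Ω → ℝ) : Prop :=
  IsHarmonizableField P (elementaryDensity H α₀ δ) X

/-- The field `X` warped by the map `Φ` of the plane: `x ↦ X(Φ(x))`. -/
def warpedField {Ω : Type*} (X : Plane → Ω → ℝ) (Φ : Plane → Plane) : Plane → Ω → ℝ :=
  fun x ω ↦ X (Φ x) ω

/-- `U'` is a version of the random field `U` with continuous sample paths: for each point `x`,
`U'(x) = U(x)` almost surely. -/
def IsContinuousVersion {Ω : Type*} [MeasurableSpace Ω] (P : Measure Ω)
    (U : Plane → Ω → ℝ) (U' : Ω → C(Plane, ℝ)) : Prop :=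
  ∀ x, (fun ω ↦ U' ω x) =ᵐ[P] U x

/-- Weak convergence of random fields: the fields `U i` and `V` have versions with continuous
sample paths, and the laws of these versions on `C(ℝ², ℝ)` converge weakly along `l`. (The law on
`C(ℝ², ℝ)` of a continuous version does not depend on the choice of the version.) -/
def ConvergesWeakly {Ω Ω' ι : Type*} [MeasurableSpace Ω] [MeasurableSpace Ω']
    (P : Measure Ω) [IsProbabilityMeasure P] (P' : Measure Ω') [IsProbabilityMeasure P']
    (U : ι → Plane → Ω → ℝ) (l : Filter ι) (V : Plane → Ω' → ℝ) : Prop :=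
  ∃ (U' : ι → Ω → C(Plane, ℝ)) (V' : Ω' → C(Plane, ℝ)),
    (∀ i, IsContinuousVersion P (U i) (U' i)) ∧ IsContinuousVersion P' V V' ∧
      TendstoInDistribution U' l V' (fun _ ↦ P) P'

/-- The field `Z` is `H`-localizable at `x₀` with tangent field `Y`: the rescaled increments
`h ↦ (Z(x₀ + ρ h) - Z(x₀)) / ρ^H` converge weakly to `Y` as `ρ → 0`, `ρ > 0`. -/
def IsLocalizableAt {Ω Ω' : Type*} [MeasurableSpace Ω] [MeasurableSpace Ω']
    (P : Measure Ω) [IsProbabilityMeasure P] (P' : Measure Ω') [IsProbabilityMeasure P']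
    (H : ℝ) (Z : Plane → Ω → ℝ) (x₀ : Plane) (Y : Plane → Ω' → ℝ) : Prop :=
  H ∈ Set.Ioo (0 : ℝ) 1 ∧
    ConvergesWeakly P P'
      (fun (ρ : Set.Ioi (0 : ℝ)) h ω ↦ (Z (x₀ + (ρ : ℝ) • h) ω - Z x₀ ω) / (ρ : ℝ) ^ H)
      (comap Subtype.val (𝓝 (0 : ℝ))) Y

end

/-!
Tangent fields of a warped elementary field.

The spectral density `f` is homogeneous of degree `-2H - 2` and `|e^{i⟨x, ξ⟩} - 1|² f(ξ)` is
integrable. Hence the covariance of the increments of `X` is invariant under translations and scales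
with the exponent `2H` (`IsHarmonizableField.integral_increment_mul`). As `X` is centered and
Gaussian, for all `a` and all `c > 0` the field `x ↦ (X (a + c x) - X a) / c ^ H` has the
finite-dimensional distributions of `X`.

This makes a tightness argument unnecessary. Let `F` be a continuous version of `X`, and let
`φ_c h = (Φ (x₀ + c h) - Φ x₀) / c`. With `a = Φ x₀`, the rescaled increment of the warped field at
`h` is the rescaled increment of `X` at `a` of scale `c`, evaluated at `φ_c h`. Its law on
`C(ℝ², ℝ)` is therefore the law of `F ∘ φ_c` (`IsElementaryField.map_rescaledIncrement_eq`), since a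
Borel measure on `C(ℝ², ℝ)` is determined by its finite-dimensional distributions
(`map_continuousMap_eq_of_finset_map_restrict_eq`). Since `Φ` is differentiable at `x₀`, `φ_c`
converges to `DΦ(x₀)` uniformly on compact sets (`tendsto_differenceQuotient`), so `F ∘ φ_c`
converges to `F ∘ DΦ(x₀)` for every outcome, hence in distribution.

The continuous version exists by the Kolmogorov–Chentsov theorem
(`IsKolmogorovProcess.exists_continuous_version`), proved by comparing the values of the process at
neighbouring points of dyadic grids. Its hypothesis holds because `X x - X y` is Gaussian with
variance `O(|x - y| ^ (2H))`, so that its absolute moment of order `3 / H` is `O(|x - y| ^ 3)`, and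
the exponent `3` exceeds the dimension.
-/

/-! ### The Borel σ-algebra of the space of continuous functions -/

/-- For a compact set `K` and an open set `U` of reals, the subbasic open set `{f | f(K) ⊆ U}` is
obtained by countably many operations from evaluations: `f(K) ⊆ U` if and only if, for some `n`,
the values of `f` on a countable dense subset of `K` stay at distance at least `1 / (n + 1)` from
the complement of `U`. -/
theorem measurableSet_mapsTo_of_measurable_eval {Ω : Type*} [MeasurableSpace Ω]
    {F : Ω → C(Plane, ℝ)} (hF : ∀ x, Measurable fun ω ↦ F ω x)
    {K : Set Plane} (hK : IsCompact K) {U : Set ℝ} (hU : IsOpen U) :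
    MeasurableSet {ω | Set.MapsTo (F ω) K U} := by
  obtain ⟨D, hDK, hDc, hKD⟩ := TopologicalSpace.IsSeparable.exists_countable_dense_subset
    (TopologicalSpace.IsSeparable.of_separableSpace K)
  let V : ℕ → Set ℝ := fun n ↦ {y | ENNReal.ofReal (1 / (n + 1)) ≤ Metric.infEDist y Uᶜ}
  have hV : ∀ n, IsClosed (V n) := fun n ↦
    isClosed_le continuous_const Metric.continuous_infEDist
  have key : {ω | Set.MapsTo (F ω) K U} = ⋃ n, ⋂ d ∈ D, {ω | F ω d ∈ V n} := by
    ext ω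
    simp only [Set.mem_ofPred_eq, Set.mem_iUnion, Set.mem_iInter]
    constructor
    · intro h
      obtain ⟨ε, hε, hεU⟩ := (hK.image (F ω).continuous).exists_thickening_subset_open hU
        h.image_subset
      obtain ⟨n, hn⟩ := exists_nat_one_div_lt hε
      refine ⟨n, fun d hd ↦ Metric.le_infEDist.2 fun y hy ↦ ?_⟩
      by_contra hlt
      refine hy (hεU (Metric.mem_thickening_iff.2 ⟨F ω d, ⟨d, hDK hd, rfl⟩, ?_⟩))
      rw [not_le, edist_dist, ENNReal.ofReal_lt_ofReal_iff (by positivity)] at hlt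
      rw [dist_comm]
      exact hlt.trans hn
    · rintro ⟨n, hn⟩ x hx
      have hmem : F ω x ∈ V n := by
        have : closure D ⊆ F ω ⁻¹' V n :=
          closure_minimal (fun d hd ↦ hn d hd) ((hV n).preimage (F ω).continuous)
        exact this (hKD hx)
      by_contra hxU
      have h0 : Metric.infEDist (F ω x) Uᶜ = 0 := Metric.infEDist_zero_of_mem hxU
      have : ENNReal.ofReal (1 / ((n : ℝ) + 1)) ≤ 0 := h0 ▸ hmem
      rw [nonpos_iff_eq_zero, ENNReal.ofReal_eq_zero] at this
      exact absurd this (not_le.2 (by positivity))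
  rw [key]
  exact .iUnion fun n ↦ .biInter hDc fun d _ ↦ hF d (hV n).measurableSet

/-- A random continuous function is measurable as soon as its values are. -/
theorem measurable_continuousMap_of_measurable_eval {Ω : Type*} [MeasurableSpace Ω]
    {F : Ω → C(Plane, ℝ)} (hF : ∀ x, Measurable fun ω ↦ F ω x) : Measurable F := by
  have h : borel C(Plane, ℝ) = _ :=
    borel_eq_generateFrom_of_subbasis ContinuousMap.compactOpen_eq
  rw [show instMeasurableSpaceContinuousPlane = borel C(Plane, ℝ) from rfl, h]
  refine measurable_generateFrom ?_
  rintro _ ⟨K, hK, U, hU, rfl⟩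
  exact measurableSet_mapsTo_of_measurable_eval hF hK hU

theorem measurable_continuousMap_eval (x : Plane) : Measurable fun f : C(Plane, ℝ) ↦ f x :=
  (continuous_eval_const x).measurable

/-- The Borel σ-algebra of `C(ℝ², ℝ)` is pulled back from the product σ-algebra of `ℝ² → ℝ`. -/
theorem measurableSpace_continuousMap_eq_comap :
    instMeasurableSpaceContinuousPlane =
      MeasurableSpace.comap (fun (f : C(Plane, ℝ)) (x : Plane) ↦ f x) MeasurableSpace.pi := by
  apply le_antisymm
  · have h := @measurable_continuousMap_of_measurable_eval C(Plane, ℝ)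
      (MeasurableSpace.comap (fun (f : C(Plane, ℝ)) (x : Plane) ↦ f x) MeasurableSpace.pi) id
      (fun x ↦ (measurable_pi_apply x).comp (comap_measurable _))
    intro s hs
    exact h hs
  · rw [← measurable_iff_comap_le]
    exact measurable_pi_lambda _ measurable_continuousMap_eval

/-- The law of a random continuous function is determined by its finite-dimensional
distributions. -/
theorem map_continuousMap_eq_of_finset_map_restrict_eq {Ω : Type*} [MeasurableSpace Ω]
    {P : Measure Ω} [IsFiniteMeasure P] {F G : Ω → C(Plane, ℝ)} (hF : Measurable F)
    (hG : Measurable G)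
    (h : ∀ I : Finset Plane, P.map (fun ω ↦ I.restrict (fun x ↦ F ω x)) =
      P.map (fun ω ↦ I.restrict (fun x ↦ G ω x))) :
    P.map F = P.map G := by
  have hev : Measurable (fun (f : C(Plane, ℝ)) (x : Plane) ↦ f x) :=
    measurable_pi_lambda _ measurable_continuousMap_eval
  have hpi := (map_eq_iff_forall_finset_map_restrict_eq (P := P)
    (X := fun x ω ↦ F ω x) (Y := fun x ω ↦ G ω x)
    (hev.comp hF).aemeasurable (hev.comp hG).aemeasurable).2 h
  ext s hs
  rw [measurableSpace_continuousMap_eq_comap] at hs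
  obtain ⟨t, ht, rfl⟩ := hs
  have := congrArg (fun μ ↦ μ t) hpi
  rw [Measure.map_apply hF (hev ht), Measure.map_apply hG (hev ht)]
  beta_reduce at this
  rwa [Measure.map_apply (f := fun ω x ↦ F ω x) (hev.comp hF) ht,
    Measure.map_apply (f := fun ω x ↦ G ω x) (hev.comp hG) ht] at this

/-! ### Centered Gaussian processes with the same covariance -/

theorem ProbabilityTheory.IsGaussianProcess.integrable_mul {Ω T : Type*} [MeasurableSpace Ω]
    {P : Measure Ω} {X : T → Ω → ℝ} (hX : IsGaussianProcess X P) (s t : T) :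
    Integrable (fun ω ↦ X s ω * X t ω) P :=
  (hX.hasGaussianLaw_eval s).memLp_two.integrable_mul (hX.hasGaussianLaw_eval t).memLp_two

/-- The second moment of a linear form of finitely many coordinates. -/
theorem ProbabilityTheory.IsGaussianProcess.integral_sq_dual {Ω T : Type*} [MeasurableSpace Ω]
    {P : Measure Ω} {X : T → Ω → ℝ} (hX : IsGaussianProcess X P) (I : Finset T) [DecidableEq I]
    (L : StrongDual ℝ (I → ℝ)) :
    ∫ ω, (L (I.restrict (X · ω))) ^ 2 ∂P = ∑ s : I, ∑ t : I,
      L (Pi.single s 1) * L (Pi.single t 1) * ∫ ω, X s ω * X t ω ∂P := by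
  have hL : ∀ ω, (L (I.restrict (X · ω))) ^ 2 = ∑ s : I, ∑ t : I,
      L (Pi.single s 1) * L (Pi.single t 1) * (X s ω * X t ω) := by
    intro ω
    have h1 : L (I.restrict (X · ω)) = ∑ s : I, X s ω * L (Pi.single s 1) := by
      conv_lhs => rw [← Finset.univ_sum_single (I.restrict (X · ω)), map_sum]
      refine Finset.sum_congr rfl fun s _ ↦ ?_
      have : (Pi.single s (I.restrict (X · ω) s) : I → ℝ) = X s ω • Pi.single s 1 := by
        ext t; by_cases h : t = s
        · subst h; simp
        · simp [h]
      rw [this, map_smul, smul_eq_mul]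
    rw [h1, sq, Finset.sum_mul_sum]
    exact Finset.sum_congr rfl fun s _ ↦ Finset.sum_congr rfl fun t _ ↦ by ring
  simp_rw [hL]
  rw [integral_finsetSum _ fun s _ ↦ integrable_finsetSum _ fun t _ ↦
    (hX.integrable_mul _ _).const_mul _]
  refine Finset.sum_congr rfl fun s _ ↦ ?_
  rw [integral_finsetSum _ fun t _ ↦ (hX.integrable_mul _ _).const_mul _]
  exact Finset.sum_congr rfl fun t _ ↦ integral_const_mul _ _

theorem ProbabilityTheory.IsGaussianProcess.integral_dual_eq_zero {Ω T : Type*}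
    [MeasurableSpace Ω] {P : Measure Ω} {X : T → Ω → ℝ} (hX : IsGaussianProcess X P)
    (hX0 : ∀ t, ∫ ω, X t ω ∂P = 0) (I : Finset T) (L : StrongDual ℝ (I → ℝ)) :
    ∫ ω, L (I.restrict (X · ω)) ∂P = 0 := by
  rw [L.integral_comp_comm (hX.hasGaussianLaw I).integrable]
  have : ∫ ω, I.restrict (X · ω) ∂P = 0 := by
    ext t
    have h := (ContinuousLinearMap.proj (R := ℝ) (φ := fun _ : I ↦ ℝ) t).integral_comp_comm
      (hX.hasGaussianLaw I).integrable
    exact h.symm.trans (hX0 t)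
  rw [this, map_zero]

/-- The finite-dimensional distributions of a centered Gaussian process are determined by its
covariance. -/
theorem ProbabilityTheory.IsGaussianProcess.map_restrict_eq_of_covariance_eq {Ω T : Type*}
    [MeasurableSpace Ω] {P : Measure Ω} {X Y : T → Ω → ℝ}
    (hX : IsGaussianProcess X P) (hY : IsGaussianProcess Y P)
    (hX0 : ∀ t, ∫ ω, X t ω ∂P = 0) (hY0 : ∀ t, ∫ ω, Y t ω ∂P = 0)
    (h : ∀ s t, ∫ ω, X s ω * X t ω ∂P = ∫ ω, Y s ω * Y t ω ∂P) (I : Finset T) :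
    P.map (fun ω ↦ I.restrict (X · ω)) = P.map (fun ω ↦ I.restrict (Y · ω)) := by
  classical
  have hPX := (hX.hasGaussianLaw I).isGaussian_map
  have hPY := (hY.hasGaussianLaw I).isGaussian_map
  refine Measure.ext_of_charFunDual (funext fun L ↦ ?_)
  rw [(hX.hasGaussianLaw I).charFunDual_map_eq_fun, (hY.hasGaussianLaw I).charFunDual_map_eq_fun,
    variance_of_integral_eq_zero
      ((hX.hasGaussianLaw I).map_fun L).aemeasurable (hX.integral_dual_eq_zero hX0 I L),
    variance_of_integral_eq_zero
      ((hY.hasGaussianLaw I).map_fun L).aemeasurable (hY.integral_dual_eq_zero hY0 I L),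
    hX.integral_sq_dual, hY.integral_sq_dual]
  simp_rw [h]
  rw [hX.integral_dual_eq_zero hX0, hY.integral_dual_eq_zero hY0]

/-! ### Continuity of functions controlled along dyadic grids -/

/-- The point `z / 2 ^ n` of the dyadic grid of level `n`. -/
noncomputable def dyadicPoint (n : ℕ) (z : Fin 2 → ℤ) : Plane :=
  WithLp.toLp 2 fun i ↦ (z i : ℝ) / 2 ^ n

/-- The index of the lower left corner of the dyadic square of level `n` that contains `x`. -/
noncomputable def dyadicIndex (n : ℕ) (x : Plane) : Fin 2 → ℤ := fun i ↦ ⌊2 ^ n * x i⌋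

theorem dyadicPoint_apply (n : ℕ) (z : Fin 2 → ℤ) (i : Fin 2) :
    dyadicPoint n z i = (z i : ℝ) / 2 ^ n := rfl

theorem dist_le_of_forall_abs_sub_le {x y : Plane} {c : ℝ} (h : ∀ i, |x i - y i| ≤ c) :
    dist x y ≤ 2 * c := by
  have hc : 0 ≤ c := (abs_nonneg _).trans (h 0)
  rw [EuclideanSpace.dist_eq, Fin.sum_univ_two]
  refine Real.sqrt_le_iff.2 ⟨by positivity, ?_⟩
  have h2 : ∀ i, dist (x i) (y i) ^ 2 ≤ c ^ 2 := fun i ↦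
    pow_le_pow_left₀ dist_nonneg (by rw [Real.dist_eq]; exact h i) 2
  nlinarith [h2 0, h2 1, sq_nonneg c]

theorem dist_dyadicPoint_dyadicIndex_le (n : ℕ) (x : Plane) :
    dist x (dyadicPoint n (dyadicIndex n x)) ≤ 2 * (2⁻¹ : ℝ) ^ n := by
  refine dist_le_of_forall_abs_sub_le fun i ↦ ?_
  have h2 : (0 : ℝ) < 2 ^ n := by positivity
  have h0 := Int.floor_le (2 ^ n * x i)
  have h1 := Int.lt_floor_add_one (2 ^ n * x i)
  have e : x i - dyadicPoint n (dyadicIndex n x) i = (2 ^ n * x i - ⌊2 ^ n * x i⌋) * 2⁻¹ ^ n := by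
    rw [dyadicPoint_apply, dyadicIndex, inv_pow]
    field_simp
  rw [e, abs_mul, abs_of_nonneg (by positivity : (0 : ℝ) ≤ 2⁻¹ ^ n)]
  refine mul_le_of_le_one_left (by positivity) (abs_le.2 ⟨by linarith, by linarith⟩)

theorem dist_dyadicPoint_le (n : ℕ) {z z' : Fin 2 → ℤ} (h : ∀ i, |z' i - z i| ≤ 1) :
    dist (dyadicPoint n z) (dyadicPoint n z') ≤ 2 * (2⁻¹ : ℝ) ^ n := by
  refine dist_le_of_forall_abs_sub_le fun i ↦ ?_
  have e : dyadicPoint n z i - dyadicPoint n z' i = ((z i - z' i : ℤ) : ℝ) * 2⁻¹ ^ n := by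
    rw [dyadicPoint_apply, dyadicPoint_apply, inv_pow]
    push_cast
    field_simp
  rw [e, abs_mul, abs_of_nonneg (by positivity : (0 : ℝ) ≤ 2⁻¹ ^ n)]
  refine mul_le_of_le_one_left (by positivity) ?_
  have hi := h i
  rw [abs_sub_comm] at hi
  rw [← Int.cast_abs]
  exact (Int.cast_le.2 hi).trans_eq Int.cast_one

/-- The dyadic grids are nested. -/
theorem dyadicPoint_succ_two_mul (n : ℕ) (z : Fin 2 → ℤ) :
    dyadicPoint (n + 1) (fun i ↦ 2 * z i) = dyadicPoint n z := by
  ext i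
  rw [dyadicPoint_apply, dyadicPoint_apply, pow_succ]
  push_cast
  field_simp

theorem abs_dyadicIndex_le {N : ℕ} {x : Plane} (hx : ∀ i, |x i| ≤ N) (n : ℕ) (i : Fin 2) :
    |dyadicIndex n x i| ≤ N * 2 ^ n := by
  have h2 : (0 : ℝ) < 2 ^ n := by positivity
  obtain ⟨h1, h3⟩ := abs_le.1 (hx i)
  refine abs_le.2 ⟨Int.le_floor.2 ?_, ?_⟩
  · push_cast
    nlinarith
  · have : ((⌊2 ^ n * x i⌋ : ℤ) : ℝ) ≤ ((N * 2 ^ n : ℤ) : ℝ) := by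
      push_cast
      nlinarith [Int.floor_le (2 ^ n * x i)]
    exact_mod_cast this

theorem abs_two_mul_dyadicIndex_sub_le (n : ℕ) (x : Plane) (i : Fin 2) :
    |2 * dyadicIndex n x i - dyadicIndex (n + 1) x i| ≤ 1 := by
  have e : (2 : ℝ) ^ (n + 1) * x i = 2 * (2 ^ n * x i) := by ring
  unfold dyadicIndex
  rw [e]
  generalize (2 : ℝ) ^ n * x i = t
  have h0 := Int.floor_le t
  have h1 := Int.lt_floor_add_one t
  have h2 : 2 * ⌊t⌋ ≤ ⌊2 * t⌋ := Int.le_floor.2 (by push_cast; linarith)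
  have h3 : ⌊2 * t⌋ < 2 * ⌊t⌋ + 2 := Int.floor_lt.2 (by push_cast; linarith)
  exact abs_le.2 ⟨by omega, by omega⟩

theorem abs_dyadicIndex_sub_le {n : ℕ} {x y : Plane} {i : Fin 2}
    (h : |y i - x i| ≤ (2⁻¹ : ℝ) ^ n) : |dyadicIndex n y i - dyadicIndex n x i| ≤ 1 := by
  have h2 : (0 : ℝ) < 2 ^ n := by positivity
  have h' : |2 ^ n * y i - 2 ^ n * x i| ≤ 1 := by
    rw [← mul_sub, abs_mul, abs_of_pos h2]
    calc (2 : ℝ) ^ n * |y i - x i| ≤ 2 ^ n * 2⁻¹ ^ n := by gcongr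
      _ = 1 := by rw [← mul_pow]; norm_num
  unfold dyadicIndex
  obtain ⟨h3, h4⟩ := abs_le.1 h'
  have a1 := Int.floor_le (2 ^ n * x i)
  have a2 := Int.lt_floor_add_one (2 ^ n * x i)
  have b1 := Int.floor_le (2 ^ n * y i)
  have b2 := Int.lt_floor_add_one (2 ^ n * y i)
  have c1 : ((⌊2 ^ n * y i⌋ - ⌊2 ^ n * x i⌋ : ℤ) : ℝ) < ((2 : ℤ) : ℝ) := by
    push_cast; linarith
  have c2 : (((-2 : ℤ)) : ℝ) < ((⌊2 ^ n * y i⌋ - ⌊2 ^ n * x i⌋ : ℤ) : ℝ) := by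
    push_cast; linarith
  have c3 := Int.cast_lt.1 c1
  have c4 := Int.cast_lt.1 c2
  exact abs_le.2 ⟨by omega, by omega⟩

/-- If the increments of `f` between neighbours of the dyadic grids decay geometrically with the
level, locally uniformly, then `f` evaluated at the dyadic approximations of `x` converges to a
continuous function of `x`. -/
theorem exists_continuousMap_tendsto_dyadic {f : Plane → ℝ} {r : ℝ} (hr0 : 0 ≤ r) (hr1 : r < 1)
    (h : ∀ N : ℕ, ∃ C : ℝ, ∀ n (z z' : Fin 2 → ℤ), (∀ i, |z i| ≤ N * 2 ^ n) →
      (∀ i, |z' i - z i| ≤ 1) → dist (f (dyadicPoint n z)) (f (dyadicPoint n z')) ≤ C * r ^ n) :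
    ∃ g : C(Plane, ℝ), ∀ x,
      Tendsto (fun n ↦ f (dyadicPoint n (dyadicIndex n x))) atTop (𝓝 (g x)) := by
  choose C hC using h
  have hC0 : ∀ N, 0 ≤ C N := fun N ↦ by
    have := hC N 0 0 0 (by simp) (by simp)
    simpa using this
  have hstep : ∀ (N : ℕ) (x : Plane), (∀ i, |x i| ≤ N) → ∀ n,
      dist (f (dyadicPoint n (dyadicIndex n x)))
        (f (dyadicPoint (n + 1) (dyadicIndex (n + 1) x))) ≤ C N * r ^ n := by
    intro N x hx n
    rw [← dyadicPoint_succ_two_mul n, dist_comm]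
    refine (hC N (n + 1) _ _ (abs_dyadicIndex_le hx (n + 1))
      (abs_two_mul_dyadicIndex_sub_le n x)).trans ?_
    exact mul_le_mul_of_nonneg_left (pow_le_pow_of_le_one hr0 hr1.le n.le_succ) (hC0 N)
  have hbox : ∀ x : Plane, ∃ N : ℕ, ∀ i, |x i| + 1 ≤ N := by
    intro x
    obtain ⟨N, hN⟩ := exists_nat_ge (‖x‖ + 1)
    exact ⟨N, fun i ↦ (add_le_add_left (PiLp.norm_apply_le x i) 1).trans hN⟩
  have hlim : ∀ x, ∃ y, Tendsto (fun n ↦ f (dyadicPoint n (dyadicIndex n x))) atTop (𝓝 y) := by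
    intro x
    obtain ⟨N, hN⟩ := hbox x
    exact cauchySeq_tendsto_of_complete (cauchySeq_of_le_geometric r (C N) hr1
      (hstep N x fun i ↦ by linarith [hN i]))
  choose g hg using hlim
  refine ⟨⟨g, continuous_iff_continuousAt.2 fun x ↦ ?_⟩, hg⟩
  obtain ⟨N, hN⟩ := hbox x
  have hx : ∀ i, |x i| ≤ N := fun i ↦ by linarith [hN i]
  -- `K r ^ n` bounds the distance of the limits at `x` and `y` from the approximations of level
  -- `n`, plus the increment between these approximations, which lie in neighbouring squares.
  set K := C N / (1 - r) + C N + C N / (1 - r) with hK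
  have hKlim : Tendsto (fun n : ℕ ↦ K * r ^ n) atTop (𝓝 0) := by
    simpa using (tendsto_pow_atTop_nhds_zero_of_lt_one hr0 hr1).const_mul K
  rw [Metric.continuousAt_iff]
  intro ε hε
  obtain ⟨n, hn⟩ := (hKlim.eventually (gt_mem_nhds hε)).exists
  refine ⟨2⁻¹ ^ n, by positivity, fun {y} hyx ↦ lt_of_le_of_lt ?_ hn⟩
  have hyi : ∀ i, |y i - x i| ≤ (2⁻¹ : ℝ) ^ n := fun i ↦
    (PiLp.norm_apply_le (y - x) i).trans (by rw [← dist_eq_norm]; exact hyx.le)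
  have hy : ∀ i, |y i| ≤ N := fun i ↦ by
    have h1 : |y i| ≤ |y i - x i| + |x i| := by simpa using abs_add_le (y i - x i) (x i)
    have h2 : (2⁻¹ : ℝ) ^ n ≤ 1 := pow_le_one₀ (by norm_num) (by norm_num)
    linarith [hN i, hyi i]
  have e1 := dist_le_of_le_geometric_of_tendsto r (C N) hr1 (hstep N x hx) (hg x) n
  have e2 := dist_le_of_le_geometric_of_tendsto r (C N) hr1 (hstep N y hy) (hg y) n
  have e3 := hC N n _ _ (abs_dyadicIndex_le hx n) fun i ↦ abs_dyadicIndex_sub_le (hyi i)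
  calc dist (g y) (g x)
      ≤ dist (g y) (f (dyadicPoint n (dyadicIndex n y))) +
          dist (f (dyadicPoint n (dyadicIndex n y))) (f (dyadicPoint n (dyadicIndex n x))) +
          dist (f (dyadicPoint n (dyadicIndex n x))) (g x) := dist_triangle4 _ _ _ _
    _ ≤ C N * r ^ n / (1 - r) + C N * r ^ n + C N * r ^ n / (1 - r) := by
        rw [dist_comm (g y), dist_comm (f (dyadicPoint n (dyadicIndex n y)))
          (f (dyadicPoint n (dyadicIndex n x)))]
        exact add_le_add_three e2 e3 e1
    _ = K * r ^ n := by rw [hK]; ring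

/-! ### The Kolmogorov–Chentsov theorem in the plane -/

section Kolmogorov

open scoped ENNReal NNReal

variable {Ω : Type*} {X : Plane → Ω → ℝ} {p q : ℝ}

/-- The indices of the points of the dyadic grid of level `n` in the square `[-N, N]²`. -/
noncomputable def dyadicBox (N n : ℕ) : Finset (Fin 2 → ℤ) :=
  Fintype.piFinset fun _ ↦ Finset.Icc (-(N * 2 ^ n : ℤ)) (N * 2 ^ n)

/-- The nine translations of `ℤ²` that lead from a point to its neighbours. -/
noncomputable def dyadicNeighbours : Finset (Fin 2 → ℤ) :=
  Fintype.piFinset fun _ ↦ Finset.Icc (-1 : ℤ) 1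

theorem card_dyadicBox_le (N n : ℕ) :
    ((dyadicBox N n).card : ℝ≥0∞) ≤ (2 * N + 1) ^ 2 * 4 ^ n := by
  have h : (dyadicBox N n).card = (2 * N * 2 ^ n + 1) ^ 2 := by
    rw [dyadicBox, Fintype.card_piFinset, Fin.prod_univ_two, Int.card_Icc, ← sq]
    congr 1
    zify
    have h0 : (0 : ℤ) ≤ N * 2 ^ n := by positivity
    rw [Int.toNat_of_nonneg (by linarith)]
    ring
  have h2 : (2 * N * 2 ^ n + 1) ^ 2 ≤ (2 * N + 1) ^ 2 * 4 ^ n := by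
    have h1 : 1 ≤ 2 ^ n := Nat.one_le_two_pow
    calc (2 * N * 2 ^ n + 1) ^ 2 ≤ (2 * N * 2 ^ n + 2 ^ n) ^ 2 := by gcongr
      _ = (2 * N + 1) ^ 2 * 4 ^ n := by
        rw [show (4 : ℕ) = 2 ^ 2 by norm_num, ← pow_mul, mul_comm 2 n, pow_mul]; ring
  rw [h]
  exact_mod_cast h2

/-- The sum over all levels `n`, with weight `2 ^ (n (q - 2) / 2)`, of the `p`-th powers of the
increments of `X` between neighbours of the dyadic grid of level `n` in `[-N, N]²`. -/
noncomputable def dyadicEnergy (X : Plane → Ω → ℝ) (p q : ℝ) (N : ℕ) (ω : Ω) : ℝ≥0∞ :=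
  ∑' n : ℕ, ∑ z ∈ dyadicBox N n, ∑ e ∈ dyadicNeighbours, ((2 : ℝ≥0∞) ^ ((q - 2) / 2)) ^ n *
    edist (X (dyadicPoint n z) ω) (X (dyadicPoint n (z + e)) ω) ^ p

/-- Finite energies bound the increments along the dyadic grids, hence give a continuous limit. -/
theorem exists_continuousMap_tendsto_of_dyadicEnergy_lt_top (hp : 0 < p) (hq : 2 < q) {ω : Ω}
    (h : ∀ N, dyadicEnergy X p q N ω < ∞) :
    ∃ g : C(Plane, ℝ), ∀ x,
      Tendsto (fun n ↦ X (dyadicPoint n (dyadicIndex n x)) ω) atTop (𝓝 (g x)) := by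
  -- A term `s ^ n * d ^ p` of the energy is at most the energy `E`, so `d ≤ E ^ (1 / p) r ^ n` with
  -- `r = s ^ (- 1 / p)`.
  set s : ℝ := 2 ^ ((q - 2) / 2) with hs
  have hs0 : 0 < s := by positivity
  have hs1 : 1 < s := Real.one_lt_rpow (by norm_num) (by linarith)
  set r : ℝ := s⁻¹ ^ p⁻¹ with hr
  have hr0 : 0 ≤ r := by positivity
  have hr1 : r < 1 := Real.rpow_lt_one (by positivity) (inv_lt_one_of_one_lt₀ hs1) (by positivity)
  refine exists_continuousMap_tendsto_dyadic (f := fun x ↦ X x ω) hr0 hr1 fun N ↦ ?_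
  refine ⟨(dyadicEnergy X p q N ω).toReal ^ p⁻¹, fun n z z' hz hz' ↦ ?_⟩
  have hle : ((2 : ℝ≥0∞) ^ ((q - 2) / 2)) ^ n *
      edist (X (dyadicPoint n z) ω) (X (dyadicPoint n z') ω) ^ p ≤ dyadicEnergy X p q N ω := by
    refine le_trans ?_ (ENNReal.le_tsum n)
    have hz0 : z ∈ dyadicBox N n :=
      Fintype.mem_piFinset.2 fun i ↦ Finset.mem_Icc.2 (abs_le.1 (hz i))
    have he0 : z' - z ∈ dyadicNeighbours :=
      Fintype.mem_piFinset.2 fun i ↦ Finset.mem_Icc.2 (abs_le.1 (hz' i))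
    refine le_trans ?_ (Finset.single_le_sum (fun _ _ ↦ zero_le) hz0)
    refine le_trans ?_ (Finset.single_le_sum (fun _ _ ↦ zero_le) he0)
    rw [add_sub_cancel]
  have hle' := ENNReal.toReal_mono (h N).ne hle
  rw [ENNReal.toReal_mul, ENNReal.toReal_pow, ← ENNReal.toReal_rpow, ← ENNReal.toReal_rpow,
    edist_dist, ENNReal.toReal_ofReal dist_nonneg, ENNReal.toReal_ofNat, ← hs] at hle'
  rw [← Real.rpow_le_rpow_iff dist_nonneg (by positivity) hp,
    Real.mul_rpow (by positivity) (by positivity), ← Real.rpow_mul (by positivity),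
    inv_mul_cancel₀ hp.ne', Real.rpow_one, ← Real.rpow_pow_comm hr0, hr,
    ← Real.rpow_mul (by positivity), inv_mul_cancel₀ hp.ne', Real.rpow_one, inv_pow,
    ← div_eq_mul_inv, le_div_iff₀ (by positivity), mul_comm]
  exact hle'

variable [MeasurableSpace Ω] {P : Measure Ω} {M : ℝ≥0}

theorem measurable_dyadicEnergy (hX : IsKolmogorovProcess X P p q M) (N : ℕ) :
    Measurable (dyadicEnergy X p q N) :=
  .tsum fun _ ↦ Finset.measurable_fun_sum _ fun _ _ ↦ Finset.measurable_fun_sum _ fun _ _ ↦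
    (hX.measurable_edist.pow_const _).const_mul _

/-- There are `O(4 ^ n)` pairs of neighbours at level `n`, each of which contributes
`O(2 ^ (n (q - 2) / 2) 2 ^ (- n q))` in expectation; the series converges because `q > 2`. -/
theorem lintegral_dyadicEnergy_ne_top (hX : IsKolmogorovProcess X P p q M) (hq : 2 < q) (N : ℕ) :
    ∫⁻ ω, dyadicEnergy X p q N ω ∂P ≠ ∞ := by
  have hmeas : ∀ n (z e : Fin 2 → ℤ), Measurable fun ω ↦ ((2 : ℝ≥0∞) ^ ((q - 2) / 2)) ^ n *
      edist (X (dyadicPoint n z) ω) (X (dyadicPoint n (z + e)) ω) ^ p := fun n z e ↦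
    (hX.measurable_edist.pow_const _).const_mul _
  have h2 : (2 : ℝ≥0∞) ≠ 0 := by norm_num
  have h2' : (2 : ℝ≥0∞) ≠ ∞ := by norm_num
  unfold dyadicEnergy
  rw [lintegral_tsum fun n ↦ (Finset.measurable_fun_sum _ fun z _ ↦
    Finset.measurable_fun_sum _ fun e _ ↦ hmeas n z e).aemeasurable]
  set A : ℝ≥0∞ := dyadicNeighbours.card * (2 * N + 1) ^ 2 * (M * 2 ^ q) with hA
  set a : ℝ≥0∞ := 2 ^ ((2 - q) / 2) with ha
  have ha1 : a < 1 := ENNReal.rpow_lt_one_of_one_lt_of_neg (by norm_num) (by linarith)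
  have hlevel : ∀ n : ℕ, ∫⁻ ω, ∑ z ∈ dyadicBox N n, ∑ e ∈ dyadicNeighbours,
      ((2 : ℝ≥0∞) ^ ((q - 2) / 2)) ^ n *
        edist (X (dyadicPoint n z) ω) (X (dyadicPoint n (z + e)) ω) ^ p ∂P ≤ A * a ^ n := by
    intro n
    rw [lintegral_finsetSum _ fun z _ ↦ Finset.measurable_fun_sum _ fun e _ ↦ hmeas n z e]
    have hterm : ∀ z ∈ dyadicBox N n, ∫⁻ ω, ∑ e ∈ dyadicNeighbours,
        ((2 : ℝ≥0∞) ^ ((q - 2) / 2)) ^ n *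
          edist (X (dyadicPoint n z) ω) (X (dyadicPoint n (z + e)) ω) ^ p ∂P ≤
        dyadicNeighbours.card * (((2 : ℝ≥0∞) ^ ((q - 2) / 2)) ^ n *
          (M * (2 * 2⁻¹ ^ n) ^ q)) := by
      intro z _
      rw [lintegral_finsetSum _ fun e _ ↦ hmeas n z e, ← nsmul_eq_mul]
      refine Finset.sum_le_card_nsmul _ _ _ fun e he ↦ ?_
      rw [lintegral_const_mul _ (hX.measurable_edist.pow_const _)]
      gcongr
      refine (hX.kolmogorovCondition _ _).trans ?_
      have hq0 := hX.q_pos.le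
      gcongr
      have hd := dist_dyadicPoint_le n (z := z) (z' := z + e) fun i ↦ by
        have := Finset.mem_Icc.1 (Fintype.mem_piFinset.1 he i)
        simpa using abs_le.2 this
      rw [edist_dist]
      refine (ENNReal.ofReal_le_ofReal hd).trans (le_of_eq ?_)
      rw [ENNReal.ofReal_mul (by norm_num), ENNReal.ofReal_pow (by norm_num),
        ENNReal.ofReal_inv_of_pos (by norm_num)]
      simp
    refine (Finset.sum_le_card_nsmul _ _ _ hterm).trans ?_
    rw [nsmul_eq_mul]
    refine (mul_le_mul_left (card_dyadicBox_le N n) _).trans (le_of_eq ?_)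
    have hpow : ((2 : ℝ≥0∞)⁻¹ ^ n) ^ q = ((2 : ℝ≥0∞) ^ (-q)) ^ n := by
      rw [ENNReal.rpow_neg, ← ENNReal.inv_rpow, ← ENNReal.rpow_natCast, ← ENNReal.rpow_natCast,
        ← ENNReal.rpow_mul, ← ENNReal.rpow_mul, mul_comm]
    have ha' : a = (2 : ℝ≥0∞) ^ ((q - 2) / 2) * 4 * 2 ^ (-q) := by
      rw [show (4 : ℝ≥0∞) = 2 ^ (2 : ℝ) by norm_num, ← ENNReal.rpow_add _ _ h2 h2',
        ← ENNReal.rpow_add _ _ h2 h2', ha]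
      congr 1
      ring
    rw [ENNReal.mul_rpow_of_nonneg _ _ hX.q_pos.le, hpow, hA, ha', mul_pow, mul_pow]
    ring
  refine ne_top_of_le_ne_top ?_ (ENNReal.tsum_le_tsum hlevel)
  rw [ENNReal.tsum_mul_left, ENNReal.tsum_geometric]
  refine ENNReal.mul_ne_top ?_ (ENNReal.inv_ne_top.2 (tsub_pos_of_lt ha1).ne')
  rw [hA]
  have : (2 : ℝ≥0∞) ^ q ≠ ∞ := ENNReal.rpow_ne_top_of_nonneg hX.q_pos.le h2'
  finiteness

/-- At a fixed point, the values of `X` at the dyadic approximations converge almost surely. -/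
theorem ae_tendsto_dyadicPoint_dyadicIndex (hX : IsKolmogorovProcess X P p q M) (x : Plane) :
    ∀ᵐ ω ∂P, Tendsto (fun n ↦ X (dyadicPoint n (dyadicIndex n x)) ω) atTop (𝓝 (X x ω)) := by
  have hmeas : ∀ n, Measurable fun ω ↦
      edist (X x ω) (X (dyadicPoint n (dyadicIndex n x)) ω) ^ p := fun n ↦
    hX.measurable_edist.pow_const _
  have hfin : ∫⁻ ω, ∑' n, edist (X x ω) (X (dyadicPoint n (dyadicIndex n x)) ω) ^ p ∂P ≠ ∞ := by
    rw [lintegral_tsum fun n ↦ (hmeas n).aemeasurable]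
    have hb : ∀ n, ∫⁻ ω, edist (X x ω) (X (dyadicPoint n (dyadicIndex n x)) ω) ^ p ∂P ≤
        (M * 2 ^ q) * ((2 : ℝ≥0∞)⁻¹ ^ q) ^ n := by
      intro n
      refine (hX.kolmogorovCondition _ _).trans ?_
      have hq0 := hX.q_pos.le
      have hed : edist x (dyadicPoint n (dyadicIndex n x)) ≤ 2 * 2⁻¹ ^ n := by
        rw [edist_dist]
        refine (ENNReal.ofReal_le_ofReal (dist_dyadicPoint_dyadicIndex_le n x)).trans
          (le_of_eq ?_)
        rw [ENNReal.ofReal_mul (by norm_num), ENNReal.ofReal_pow (by norm_num),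
          ENNReal.ofReal_inv_of_pos (by norm_num)]
        simp
      calc (M : ℝ≥0∞) * edist x (dyadicPoint n (dyadicIndex n x)) ^ q
          ≤ M * (2 * 2⁻¹ ^ n) ^ q := by gcongr
        _ = (M * 2 ^ q) * ((2 : ℝ≥0∞)⁻¹ ^ q) ^ n := by
          rw [ENNReal.mul_rpow_of_nonneg _ _ hq0, ← ENNReal.rpow_natCast, ← ENNReal.rpow_natCast,
            ← ENNReal.rpow_mul, ← ENNReal.rpow_mul, mul_comm (n : ℝ), mul_assoc]
    refine ne_top_of_le_ne_top ?_ (ENNReal.tsum_le_tsum hb)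
    rw [ENNReal.tsum_mul_left, ENNReal.tsum_geometric]
    have h1 : (2 : ℝ≥0∞)⁻¹ ^ q < 1 :=
      ENNReal.rpow_lt_one (ENNReal.inv_lt_one.2 (by norm_num)) hX.q_pos
    have h2 : (2 : ℝ≥0∞) ^ q ≠ ∞ := ENNReal.rpow_ne_top_of_nonneg hX.q_pos.le (by norm_num)
    refine ENNReal.mul_ne_top (by finiteness) (ENNReal.inv_ne_top.2 (tsub_pos_of_lt h1).ne')
  filter_upwards [ae_lt_top (Measurable.tsum hmeas) hfin] with ω hω
  have h0 := ENNReal.tendsto_atTop_zero_of_tsum_ne_top hω.ne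
  rw [tendsto_iff_edist_tendsto_0]
  have h1 := (ENNReal.continuous_rpow_const (y := p⁻¹)).tendsto 0 |>.comp h0
  rw [ENNReal.zero_rpow_of_pos (inv_pos.2 hX.p_pos)] at h1
  refine h1.congr fun n ↦ ?_
  rw [Function.comp_apply, ← ENNReal.rpow_mul, mul_inv_cancel₀ hX.p_pos.ne', ENNReal.rpow_one,
    edist_comm]

/-- **Kolmogorov–Chentsov theorem** in the plane: a process with
`E|X s - X t| ^ p ≤ M |s - t| ^ q` for some `q > 2` has a continuous version. -/
theorem ProbabilityTheory.IsKolmogorovProcess.exists_continuous_version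
    (hX : IsKolmogorovProcess X P p q M) (hq : 2 < q) :
    ∃ F : Ω → C(Plane, ℝ), Measurable F ∧ IsContinuousVersion P X F := by
  -- Outside of the measurable set `G` of full measure, paths are replaced by zero, so that the limit
  -- along dyadic points exists and is continuous for every outcome and is measurable.
  set G : Set Ω := {ω | ∀ N, dyadicEnergy X p q N ω < ∞} with hG
  have hGm : MeasurableSet G := by
    rw [hG, Set.ofPred_forall]
    exact .iInter fun N ↦ measurableSet_lt (measurable_dyadicEnergy hX N) measurable_const
  have hGP : ∀ᵐ ω ∂P, ω ∈ G := ae_all_iff.2 fun N ↦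
    ae_lt_top (measurable_dyadicEnergy hX N) (lintegral_dyadicEnergy_ne_top hX hq N)
  have hex : ∀ ω, ∃ g : C(Plane, ℝ), ∀ x, Tendsto
      (fun n ↦ G.indicator (X (dyadicPoint n (dyadicIndex n x))) ω) atTop (𝓝 (g x)) := by
    intro ω
    by_cases hω : ω ∈ G
    · simpa only [Set.indicator_of_mem hω] using
        exists_continuousMap_tendsto_of_dyadicEnergy_lt_top hX.p_pos hq hω
    · exact ⟨0, fun x ↦ by simp [Set.indicator_of_notMem hω]⟩
  choose F hF using hex
  refine ⟨F, measurable_continuousMap_of_measurable_eval fun x ↦ ?_, fun x ↦ ?_⟩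
  · exact measurable_of_tendsto_metrizable
      (fun n ↦ (hX.measurable (dyadicPoint n (dyadicIndex n x))).indicator hGm)
      (tendsto_pi_nhds.2 fun ω ↦ hF ω x)
  · filter_upwards [hGP, ae_tendsto_dyadicPoint_dyadicIndex hX x] with ω hω hx
    refine tendsto_nhds_unique (hF ω x) ?_
    simpa only [Set.indicator_of_mem hω] using hx

end Kolmogorov

/-! ### Covariance of fields with a homogeneous spectral density -/

theorem norm_harmonizableKernel_le (x ξ : Plane) :
    ‖harmonizableKernel x ξ‖ ≤ (‖x‖ + 2) * min ‖ξ‖ 1 := by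
  have h1 : ‖harmonizableKernel x ξ‖ ≤ ‖x‖ * ‖ξ‖ :=
    (Real.norm_exp_I_mul_ofReal_sub_one_le).trans (abs_real_inner_le_norm x ξ)
  have h2 : ‖harmonizableKernel x ξ‖ ≤ 2 := by
    refine (norm_sub_le _ _).trans ?_
    rw [mul_comm, Complex.norm_exp_ofReal_mul_I, norm_one]
    norm_num
  have hx := norm_nonneg x
  have hξ := norm_nonneg ξ
  rcases le_total ‖ξ‖ 1 with h | h
  · rw [min_eq_left h]
    nlinarith
  · rw [min_eq_right h]
    linarith

theorem continuous_harmonizableKernel (x : Plane) : Continuous (harmonizableKernel x) := by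
  unfold harmonizableKernel
  fun_prop

theorem harmonizableKernel_smul (c : ℝ) (x ξ : Plane) :
    harmonizableKernel (c • x) ξ = harmonizableKernel x (c • ξ) := by
  simp only [harmonizableKernel, real_inner_smul_left, real_inner_smul_right]

/-- The increments of the kernel are translates of the kernel, up to a phase. -/
theorem harmonizableKernel_add_sub (a x ξ : Plane) :
    harmonizableKernel (a + x) ξ - harmonizableKernel a ξ =
      Complex.exp (Complex.I * (inner ℝ a ξ : ℝ)) * harmonizableKernel x ξ := by
  simp only [harmonizableKernel, inner_add_left, Complex.ofReal_add, mul_add, Complex.exp_add]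
  ring

/-- The integrand of the covariance of a harmonizable field with spectral density `f`. -/
noncomputable def covarianceIntegrand (f : Plane → ℝ) (x y ξ : Plane) : ℂ :=
  harmonizableKernel x ξ * (starRingEnd ℂ) (harmonizableKernel y ξ) * (f ξ : ℂ)

theorem norm_covarianceIntegrand_le (f : Plane → ℝ) (x y ξ : Plane) :
    ‖covarianceIntegrand f x y ξ‖ ≤
      ((‖x‖ + 2) * (‖y‖ + 2)) * ‖(min ‖ξ‖ 1) ^ 2 * f ξ‖ := by
  have h0 : 0 ≤ min ‖ξ‖ 1 := le_min (norm_nonneg _) zero_le_one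
  rw [covarianceIntegrand, norm_mul, norm_mul, RCLike.norm_conj, Complex.norm_real, norm_mul,
    Real.norm_of_nonneg (sq_nonneg (min ‖ξ‖ 1))]
  calc ‖harmonizableKernel x ξ‖ * ‖harmonizableKernel y ξ‖ * ‖f ξ‖
      ≤ ((‖x‖ + 2) * min ‖ξ‖ 1) * ((‖y‖ + 2) * min ‖ξ‖ 1) * ‖f ξ‖ := by
        gcongr
        · exact norm_harmonizableKernel_le x ξ
        · exact norm_harmonizableKernel_le y ξ
    _ = _ := by ring

theorem integrable_covarianceIntegrand {f : Plane → ℝ} (hfm : Measurable f)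
    (hf : Integrable fun ξ ↦ (min ‖ξ‖ 1) ^ 2 * f ξ) (x y : Plane) :
    Integrable (covarianceIntegrand f x y) := by
  refine (hf.norm.const_mul ((‖x‖ + 2) * (‖y‖ + 2))).mono' ?_
    (.of_forall (norm_covarianceIntegrand_le f x y))
  refine Measurable.aestronglyMeasurable ?_
  exact ((continuous_harmonizableKernel x).measurable.mul
    (Complex.continuous_conj.comp (continuous_harmonizableKernel y)).measurable).mul
      (Complex.measurable_ofReal.comp hfm)

theorem covarianceIntegrand_increments (f : Plane → ℝ) (a x y ξ : Plane) :
    covarianceIntegrand f (a + x) (a + y) ξ - covarianceIntegrand f (a + x) a ξ -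
      covarianceIntegrand f a (a + y) ξ + covarianceIntegrand f a a ξ =
      covarianceIntegrand f x y ξ := by
  -- The phase `u` of the increments has modulus one, hence cancels.
  set u := Complex.exp (Complex.I * (inner ℝ a ξ : ℝ)) with hu
  have hu1 : u * (starRingEnd ℂ) u = 1 := by
    rw [Complex.mul_conj, Complex.normSq_eq_norm_sq, hu, mul_comm Complex.I,
      Complex.norm_exp_ofReal_mul_I]
    norm_num
  calc _ = (harmonizableKernel (a + x) ξ - harmonizableKernel a ξ) *
        (starRingEnd ℂ) (harmonizableKernel (a + y) ξ - harmonizableKernel a ξ) * (f ξ : ℂ) := by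
        simp only [covarianceIntegrand, map_sub]
        ring
    _ = u * (starRingEnd ℂ) u * covarianceIntegrand f x y ξ := by
        rw [harmonizableKernel_add_sub, harmonizableKernel_add_sub, map_mul, covarianceIntegrand]
        ring
    _ = covarianceIntegrand f x y ξ := by rw [hu1, one_mul]

theorem covarianceIntegrand_smul {f : Plane → ℝ} {H : ℝ}
    (hom : ∀ c : ℝ, 0 < c → ∀ ξ, f (c • ξ) = c ^ (-2 * H - 2) * f ξ) {c : ℝ} (hc : 0 < c)
    (x y ξ : Plane) :
    covarianceIntegrand f (c • x) (c • y) ξ =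
      ((c ^ (2 * H + 2) : ℝ) : ℂ) * covarianceIntegrand f x y (c • ξ) := by
  have h : f ξ = c ^ (2 * H + 2) * f (c • ξ) := by
    rw [hom c hc, ← mul_assoc, ← Real.rpow_add hc]
    ring_nf
    simp
  simp only [covarianceIntegrand, harmonizableKernel_smul]
  rw [h]
  push_cast
  ring

theorem integral_covarianceIntegrand_smul {f : Plane → ℝ} {H : ℝ}
    (hom : ∀ c : ℝ, 0 < c → ∀ ξ, f (c • ξ) = c ^ (-2 * H - 2) * f ξ) {c : ℝ} (hc : 0 < c)
    (x y : Plane) :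
    ∫ ξ, covarianceIntegrand f (c • x) (c • y) ξ =
      ((c ^ (2 * H) : ℝ) : ℂ) * ∫ ξ, covarianceIntegrand f x y ξ := by
  simp_rw [covarianceIntegrand_smul hom hc]
  rw [integral_const_mul, Measure.integral_comp_smul_of_nonneg _ _ _ (hR := hc.le),
    finrank_euclideanSpace_fin, Complex.real_smul, ← mul_assoc, ← Complex.ofReal_mul,
    Real.rpow_add hc, Real.rpow_two, mul_assoc, mul_inv_cancel₀ (by positivity), mul_one]

theorem integral_sub_sub_add {α E : Type*} [MeasurableSpace α] [NormedAddCommGroup E]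
    [NormedSpace ℝ E] {μ : Measure α} {f₁ f₂ f₃ f₄ : α → E} (h₁ : Integrable f₁ μ)
    (h₂ : Integrable f₂ μ) (h₃ : Integrable f₃ μ) (h₄ : Integrable f₄ μ) :
    ∫ x, f₁ x - f₂ x - f₃ x + f₄ x ∂μ =
      ∫ x, f₁ x ∂μ - ∫ x, f₂ x ∂μ - ∫ x, f₃ x ∂μ + ∫ x, f₄ x ∂μ := by
  have h₁₂ : Integrable (fun x ↦ f₁ x - f₂ x) μ := h₁.sub h₂
  have h₁₂₃ : Integrable (fun x ↦ f₁ x - f₂ x - f₃ x) μ := h₁₂.sub h₃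
  rw [integral_add h₁₂₃ h₄, integral_sub h₁₂ h₃, integral_sub h₁ h₂]

/-- Increments of a harmonizable field with a spectral density homogeneous of degree `-2H - 2`
are stationary and self-similar of index `H`. -/
theorem IsHarmonizableField.integral_increment_mul {Ω : Type*} [MeasurableSpace Ω]
    {P : Measure Ω} {f : Plane → ℝ} {X : Plane → Ω → ℝ} (hX : IsHarmonizableField P f X)
    (hfm : Measurable f) (hf : Integrable fun ξ ↦ (min ‖ξ‖ 1) ^ 2 * f ξ) {H : ℝ}
    (hom : ∀ c : ℝ, 0 < c → ∀ ξ, f (c • ξ) = c ^ (-2 * H - 2) * f ξ) {c : ℝ} (hc : 0 < c)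
    (a x y : Plane) :
    ∫ ω, (X (a + c • x) ω - X a ω) * (X (a + c • y) ω - X a ω) ∂P =
      c ^ (2 * H) * ∫ ω, X x ω * X y ω ∂P := by
  have hI := integrable_covarianceIntegrand hfm hf
  have hXI := hX.gaussian.integrable_mul
  have hcov : ∀ x y, ((∫ ω, X x ω * X y ω ∂P : ℝ) : ℂ) = ∫ ξ, covarianceIntegrand f x y ξ :=
    hX.covariance
  have hexp : ∀ ω, (X (a + c • x) ω - X a ω) * (X (a + c • y) ω - X a ω) =
      X (a + c • x) ω * X (a + c • y) ω - X (a + c • x) ω * X a ω -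
        X a ω * X (a + c • y) ω + X a ω * X a ω := fun ω ↦ by ring
  simp_rw [hexp]
  rw [integral_sub_sub_add (hXI _ _) (hXI _ _) (hXI _ _) (hXI _ _)]
  apply Complex.ofReal_injective
  rw [Complex.ofReal_add, Complex.ofReal_sub, Complex.ofReal_sub, Complex.ofReal_mul, hcov, hcov,
    hcov, hcov, hcov, ← integral_covarianceIntegrand_smul hom hc,
    ← integral_sub_sub_add (hI _ _) (hI _ _) (hI _ _) (hI _ _)]
  exact integral_congr_ae (.of_forall (covarianceIntegrand_increments f a _ _))

theorem IsHarmonizableField.integral_sq_le {Ω : Type*} [MeasurableSpace Ω]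
    {P : Measure Ω} {f : Plane → ℝ} {X : Plane → Ω → ℝ} (hX : IsHarmonizableField P f X)
    (hf : Integrable fun ξ ↦ (min ‖ξ‖ 1) ^ 2 * f ξ) (x : Plane) :
    ∫ ω, X x ω * X x ω ∂P ≤ (‖x‖ + 2) ^ 2 * ∫ ξ, ‖(min ‖ξ‖ 1) ^ 2 * f ξ‖ := by
  calc ∫ ω, X x ω * X x ω ∂P ≤ ‖((∫ ω, X x ω * X x ω ∂P : ℝ) : ℂ)‖ := by
        rw [Complex.norm_real]; exact Real.le_norm_self _
    _ = ‖∫ ξ, covarianceIntegrand f x x ξ‖ := congrArg norm (hX.covariance x x)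
    _ ≤ ∫ ξ, (‖x‖ + 2) * (‖x‖ + 2) * ‖(min ‖ξ‖ 1) ^ 2 * f ξ‖ :=
        norm_integral_le_of_norm_le (hf.norm.const_mul _)
          (.of_forall (norm_covarianceIntegrand_le f x x))
    _ = _ := by rw [integral_const_mul, sq]

/-- The variogram of a field with homogeneous spectral density is `O(|x - y| ^ (2H))`: by
homogeneity it suffices to bound the variance on the unit circle. -/
theorem IsHarmonizableField.exists_integral_sub_sq_le {Ω : Type*} [MeasurableSpace Ω]
    {P : Measure Ω} {f : Plane → ℝ} {X : Plane → Ω → ℝ} (hX : IsHarmonizableField P f X)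
    (hfm : Measurable f) (hf : Integrable fun ξ ↦ (min ‖ξ‖ 1) ^ 2 * f ξ) {H : ℝ}
    (hom : ∀ c : ℝ, 0 < c → ∀ ξ, f (c • ξ) = c ^ (-2 * H - 2) * f ξ) :
    ∃ C : ℝ, ∀ x y, ∫ ω, (X x ω - X y ω) ^ 2 ∂P ≤ C * (dist x y ^ H) ^ 2 := by
  have hC : 0 ≤ ∫ ξ : Plane, ‖(min ‖ξ‖ 1) ^ 2 * f ξ‖ := integral_nonneg fun _ ↦ norm_nonneg _
  refine ⟨9 * ∫ ξ, ‖(min ‖ξ‖ 1) ^ 2 * f ξ‖, fun x y ↦ ?_⟩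
  rcases eq_or_ne x y with rfl | hxy
  · simp only [sub_self, ne_eq, OfNat.ofNat_ne_zero, not_false_eq_true, zero_pow, integral_zero]
    positivity
  have hd : 0 < dist x y := dist_pos.2 hxy
  set u : Plane := (dist x y)⁻¹ • (x - y) with hu
  have hu1 : ‖u‖ = 1 := by
    rw [hu, norm_smul, Real.norm_of_nonneg (by positivity), ← dist_eq_norm, inv_mul_cancel₀ hd.ne']
  have hxu : x = y + dist x y • u := by
    rw [hu, smul_inv_smul₀ hd.ne', add_sub_cancel]
  have h := hX.integral_increment_mul hfm hf hom hd y u u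
  rw [← hxu] at h
  simp_rw [sq (X x _ - X y _)]
  rw [h, two_mul, Real.rpow_add hd, ← sq, mul_comm]
  gcongr
  refine (hX.integral_sq_le hf u).trans (le_of_eq ?_)
  rw [hu1]
  norm_num

/-! ### The density of the elementary field -/

theorem measurable_elementaryAnisotropy (α₀ δ : ℝ) :
    Measurable (elementaryAnisotropy α₀ δ) := by
  have harg : Measurable planeArg := by
    have : Measurable fun ξ : Plane ↦ (⟨ξ 0, ξ 1⟩ : ℂ) := by
      have h : (fun ξ : Plane ↦ (⟨ξ 0, ξ 1⟩ : ℂ)) =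
          fun ξ : Plane ↦ ((ξ 0 : ℝ) : ℂ) + ((ξ 1 : ℝ) : ℂ) * Complex.I := by
        funext ξ; exact Complex.mk_eq_add_mul_I _ _
      rw [h]
      fun_prop
    exact Complex.measurable_arg.comp this
  classical
  refine Measurable.ite ?_ measurable_const measurable_const
  rw [Set.ofPred_exists]
  exact .iUnion fun k ↦ measurableSet_Icc.preimage ((harg.sub_const _).sub_const _)

theorem measurable_elementaryDensity (H α₀ δ : ℝ) : Measurable (elementaryDensity H α₀ δ) :=
  (measurable_norm.pow_const _).mul ((measurable_elementaryAnisotropy α₀ δ).comp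
    (measurable_norm.inv.smul measurable_id))

theorem norm_elementaryAnisotropy_le (α₀ δ : ℝ) (Θ : Plane) :
    ‖elementaryAnisotropy α₀ δ Θ‖ ≤ ‖1 / (2 * δ)‖ := by
  unfold elementaryAnisotropy
  split_ifs
  · exact le_rfl
  · simp

theorem elementaryDensity_smul {H : ℝ} (α₀ δ : ℝ) {c : ℝ} (hc : 0 < c) (ξ : Plane) :
    elementaryDensity H α₀ δ (c • ξ) = c ^ (-2 * H - 2) * elementaryDensity H α₀ δ ξ := by
  have h : ‖c • ξ‖⁻¹ • (c • ξ) = ‖ξ‖⁻¹ • ξ := by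
    rw [norm_smul, Real.norm_of_nonneg hc.le, smul_smul, mul_inv, mul_comm c⁻¹, mul_assoc,
      inv_mul_cancel₀ hc.ne', mul_one]
  rw [elementaryDensity, elementaryDensity, h, norm_smul, Real.norm_of_nonneg hc.le,
    Real.mul_rpow hc.le (norm_nonneg _), mul_assoc]

/-- In polar coordinates the integrand is `r ^ (1 - 2H)` for `r ≤ 1` and `r ^ (-1 - 2H)` for
`r > 1`. -/
theorem integrable_min_norm_sq_mul_rpow {H : ℝ} (hH : H ∈ Set.Ioo (0 : ℝ) 1) :
    Integrable fun ξ : Plane ↦ (min ‖ξ‖ 1) ^ 2 * ‖ξ‖ ^ (-2 * H - 2) := by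
  refine (integrable_fun_norm_addHaar volume
    (f := fun r : ℝ ↦ (min r 1) ^ 2 * r ^ (-2 * H - 2))).2 ?_
  rw [finrank_euclideanSpace_fin, ← Set.Ioc_union_Ioi_eq_Ioi zero_le_one]
  refine IntegrableOn.union ?_ ?_
  · have h : IntegrableOn (fun r : ℝ ↦ r ^ (1 - 2 * H)) (Set.Ioc 0 1) :=
      (intervalIntegrable_iff_integrableOn_Ioc_of_le zero_le_one).1
        (intervalIntegral.intervalIntegrable_rpow' (by linarith [hH.2]))
    refine h.congr_fun (fun r hr ↦ ?_) measurableSet_Ioc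
    have hr0 : 0 < r := hr.1
    simp only [min_eq_left hr.2, smul_eq_mul]
    rw [show 1 - 2 * H = 1 + (2 + (-2 * H - 2)) by ring, Real.rpow_add hr0, Real.rpow_add hr0,
      Real.rpow_one, Real.rpow_two]
    simp
  · have h : IntegrableOn (fun r : ℝ ↦ r ^ (-1 - 2 * H)) (Set.Ioi 1) :=
      integrableOn_Ioi_rpow_of_lt (by linarith [hH.1]) one_pos
    refine h.congr_fun (fun r hr ↦ ?_) measurableSet_Ioi
    have hr1 : 1 < r := hr
    have hr0 : 0 < r := one_pos.trans hr1
    simp only [min_eq_right hr1.le, smul_eq_mul]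
    rw [show -1 - 2 * H = 1 + (-2 * H - 2) by ring, Real.rpow_add hr0, Real.rpow_one]
    simp

theorem integrable_min_norm_sq_mul_elementaryDensity {H : ℝ} (hH : H ∈ Set.Ioo (0 : ℝ) 1)
    (α₀ δ : ℝ) : Integrable fun ξ : Plane ↦ (min ‖ξ‖ 1) ^ 2 * elementaryDensity H α₀ δ ξ := by
  have h := (integrable_min_norm_sq_mul_rpow hH).mul_bdd (c := ‖1 / (2 * δ)‖)
    (((measurable_elementaryAnisotropy α₀ δ).comp
      (measurable_norm.inv.smul measurable_id)).aestronglyMeasurable)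
    (.of_forall fun ξ ↦ norm_elementaryAnisotropy_le α₀ δ (‖ξ‖⁻¹ • ξ))
  refine h.congr (.of_forall fun ξ ↦ ?_)
  simp only [elementaryDensity, Function.comp_apply]
  rw [mul_assoc]
  rfl

/-! ### Gaussian moments and the continuous version -/

open scoped ENNReal NNReal

/-- The moments of a centered Gaussian variable are powers of its standard deviation. -/
theorem ProbabilityTheory.HasGaussianLaw.lintegral_enorm_rpow {Ω : Type*} [MeasurableSpace Ω]
    {P : Measure Ω} {Z : Ω → ℝ} (hZ : HasGaussianLaw Z P) (hZ0 : ∫ ω, Z ω ∂P = 0) {p : ℝ}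
    (hp : 0 ≤ p) :
    ∫⁻ ω, ‖Z ω‖ₑ ^ p ∂P =
      ENNReal.ofReal √(∫ ω, Z ω ^ 2 ∂P) ^ p * ∫⁻ x, ‖x‖ₑ ^ p ∂(gaussianReal 0 1) := by
  have hlaw : P.map Z = (gaussianReal 0 1).map (√(∫ ω, Z ω ^ 2 ∂P) * ·) := by
    rw [hZ.map_eq_gaussianReal, gaussianReal_map_const_mul,
      variance_of_integral_eq_zero hZ.aemeasurable hZ0, hZ0, mul_zero, mul_one]
    congr 1
    ext
    rw [Real.coe_toNNReal _ (integral_nonneg fun _ ↦ sq_nonneg _)]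
    exact (Real.sq_sqrt (integral_nonneg fun _ ↦ sq_nonneg _)).symm
  have hm : Measurable fun x : ℝ ↦ ‖x‖ₑ ^ p := measurable_enorm.pow_const _
  rw [← lintegral_map' hm.aemeasurable hZ.aemeasurable, hlaw,
    lintegral_map hm (measurable_const_mul _), ← lintegral_const_mul _ hm]
  refine lintegral_congr fun x ↦ ?_
  rw [enorm_mul, ENNReal.mul_rpow_of_nonneg _ _ hp, Real.enorm_of_nonneg (Real.sqrt_nonneg _)]

theorem lintegral_enorm_rpow_gaussianReal_ne_top {p : ℝ} (hp : 0 < p) :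
    ∫⁻ x, ‖x‖ₑ ^ p ∂(gaussianReal 0 1) ≠ ∞ := by
  have h := (memLp_id_gaussianReal' (μ := 0) (v := 1) (ENNReal.ofReal p)
    ENNReal.ofReal_ne_top).eLpNorm_lt_top
  have h' := lintegral_rpow_enorm_lt_top_of_eLpNorm_lt_top (by simpa using hp)
    ENNReal.ofReal_ne_top h
  rw [ENNReal.toReal_ofReal hp.le] at h'
  exact h'.ne

/-- A centered Gaussian process whose variogram is `O(|x - y| ^ (2H))` satisfies the Kolmogorov
condition with exponents `q / H` and `q`, for every `q > 0`. -/
theorem ProbabilityTheory.IsGaussianProcess.exists_isAEKolmogorovProcess {Ω T : Type*}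
    [MeasurableSpace Ω] [PseudoMetricSpace T] {P : Measure Ω} {X : T → Ω → ℝ}
    (hX : IsGaussianProcess X P) (hX0 : ∀ t, ∫ ω, X t ω ∂P = 0) {H C q : ℝ} (hH : 0 < H)
    (hq : 0 < q) (h : ∀ x y, ∫ ω, (X x ω - X y ω) ^ 2 ∂P ≤ C * (dist x y ^ H) ^ 2) :
    ∃ M : ℝ≥0, IsAEKolmogorovProcess X P (q / H) q M := by
  set p := q / H with hp
  have hp0 : 0 < p := by positivity
  have hint : ∀ t, Integrable (X t) P := fun t ↦ (hX.hasGaussianLaw_eval t).integrable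
  set c : ℝ≥0∞ := ∫⁻ x, ‖x‖ₑ ^ p ∂(gaussianReal 0 1) with hc
  have hM : ENNReal.ofReal √C ^ p * c ≠ ∞ :=
    ENNReal.mul_ne_top (ENNReal.rpow_ne_top_of_nonneg hp0.le ENNReal.ofReal_ne_top)
      (lintegral_enorm_rpow_gaussianReal_ne_top hp0)
  have hmk : ∀ t, X t =ᵐ[P] (hX.aemeasurable t).mk (X t) := fun t ↦ (hX.aemeasurable t).ae_eq_mk
  refine ⟨(ENNReal.ofReal √C ^ p * c).toNNReal, fun t ↦ (hX.aemeasurable t).mk (X t),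
    .mk_of_secondCountableTopology (fun t ↦ (hX.aemeasurable t).measurable_mk) (fun s t ↦ ?_)
      hp0 hq, hmk⟩
  rw [ENNReal.coe_toNNReal hM]
  calc ∫⁻ ω, edist ((hX.aemeasurable s).mk (X s) ω) ((hX.aemeasurable t).mk (X t) ω) ^ p ∂P
      = ∫⁻ ω, ‖X s ω - X t ω‖ₑ ^ p ∂P := by
        refine lintegral_congr_ae ?_
        filter_upwards [hmk s, hmk t] with ω hs ht
        rw [← hs, ← ht, edist_eq_enorm_sub]
    _ = ENNReal.ofReal √(∫ ω, (X s ω - X t ω) ^ 2 ∂P) ^ p * c :=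
        hX.hasGaussianLaw_fun_sub.lintegral_enorm_rpow
          (by rw [integral_sub (hint s) (hint t), hX0, hX0, sub_zero]) hp0.le
    _ ≤ ENNReal.ofReal (√C * dist s t ^ H) ^ p * c := by
        gcongr
        refine (Real.sqrt_le_sqrt (h s t)).trans (le_of_eq ?_)
        rw [Real.sqrt_mul' _ (sq_nonneg _), Real.sqrt_sq (by positivity)]
    _ = ENNReal.ofReal √C ^ p * c * edist s t ^ q := by
        rw [ENNReal.ofReal_mul (Real.sqrt_nonneg _), ENNReal.mul_rpow_of_nonneg _ _ hp0.le,
          ← ENNReal.ofReal_rpow_of_nonneg dist_nonneg hH.le, ← edist_dist, ← ENNReal.rpow_mul,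
          hp, mul_div_cancel₀ _ hH.ne']
        ring

theorem IsElementaryField.exists_continuous_version {Ω : Type*} [MeasurableSpace Ω]
    {P : Measure Ω} {H α₀ δ : ℝ} (hH : H ∈ Set.Ioo (0 : ℝ) 1) {X : Plane → Ω → ℝ}
    (hX : IsElementaryField P H α₀ δ X) :
    ∃ F : Ω → C(Plane, ℝ), Measurable F ∧ IsContinuousVersion P X F := by
  obtain ⟨C, hC⟩ := IsHarmonizableField.exists_integral_sub_sq_le hX
    (measurable_elementaryDensity H α₀ δ) (integrable_min_norm_sq_mul_elementaryDensity hH α₀ δ)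
    fun c hc ξ ↦ elementaryDensity_smul α₀ δ hc ξ
  -- The exponent `q = 3` exceeds the dimension of the plane.
  obtain ⟨M, hM⟩ := hX.gaussian.exists_isAEKolmogorovProcess hX.centered hH.1
    (q := 3) (by norm_num) hC
  obtain ⟨F, hF, hFX⟩ := hM.IsKolmogorovProcess_mk.exists_continuous_version (by norm_num)
  exact ⟨F, hF, fun x ↦ (hFX x).trans (hM.ae_eq_mk x).symm⟩

/-- The rescaled increments of an elementary field have the finite-dimensional distributions of
the field itself. -/
theorem IsElementaryField.map_restrict_rescaled_increment_eq {Ω : Type*} [MeasurableSpace Ω]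
    {P : Measure Ω} {H α₀ δ : ℝ} (hH : H ∈ Set.Ioo (0 : ℝ) 1) {X : Plane → Ω → ℝ}
    (hX : IsElementaryField P H α₀ δ X) (a : Plane) {c : ℝ} (hc : 0 < c) (I : Finset Plane) :
    P.map (fun ω ↦ I.restrict fun x ↦ (X (a + c • x) ω - X a ω) / c ^ H) =
      P.map (fun ω ↦ I.restrict (X · ω)) := by
  have hgauss : IsGaussianProcess (fun x ω ↦ (X (a + c • x) ω - X a ω) / c ^ H) P := by
    classical
    refine hX.gaussian.of_isGaussianProcess fun x ↦ ⟨{a + c • x, a},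
      (c ^ H)⁻¹ • (ContinuousLinearMap.proj ⟨a + c • x, by simp⟩ -
        ContinuousLinearMap.proj ⟨a, by simp⟩), fun ω ↦ ?_⟩
    simp [div_eq_inv_mul]
  refine hgauss.map_restrict_eq_of_covariance_eq hX.gaussian (fun x ↦ ?_) hX.centered
    (fun x y ↦ ?_) I
  · rw [integral_div, integral_sub (hX.gaussian.hasGaussianLaw_eval _).integrable
      (hX.gaussian.hasGaussianLaw_eval _).integrable, hX.centered, hX.centered, sub_zero, zero_div]
  · simp_rw [div_mul_div_comm]
    rw [integral_div, IsHarmonizableField.integral_increment_mul hX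
      (measurable_elementaryDensity H α₀ δ) (integrable_min_norm_sq_mul_elementaryDensity hH α₀ δ)
      (fun c hc ξ ↦ elementaryDensity_smul α₀ δ hc ξ) hc, two_mul, Real.rpow_add hc,
      mul_div_cancel_left₀ _ (by positivity)]

/-! ### Rescaling a warped field -/

/-- The rescaled increment `x ↦ (g (a + c x) - g a) / c ^ H` of a continuous function `g`. -/
noncomputable def rescaledIncrement (H : ℝ) (a : Plane) (c : ℝ) (g : C(Plane, ℝ)) :
    C(Plane, ℝ) :=
  ⟨fun x ↦ (g (a + c • x) - g a) / c ^ H, by fun_prop⟩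

/-- The rescaled increment `h ↦ (Φ (x₀ + c h) - Φ x₀) / c` of a continuous map `Φ` of the plane,
whose limit as `c → 0` is the differential of `Φ` at `x₀`. -/
noncomputable def differenceQuotient {Φ : Plane → Plane} (hΦ : Continuous Φ) (x₀ : Plane) (c : ℝ) :
    C(Plane, Plane) :=
  ⟨fun h ↦ c⁻¹ • (Φ (x₀ + c • h) - Φ x₀), by fun_prop⟩

/-- The difference quotients of a differentiable map converge to its differential uniformly on
compact sets. -/
theorem tendsto_differenceQuotient {Φ : Plane → Plane} (hΦ : Continuous Φ) {x₀ : Plane}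
    {D : Plane →L[ℝ] Plane} (hD : HasFDerivAt Φ D x₀) :
    Tendsto (fun c : Set.Ioi (0 : ℝ) ↦ differenceQuotient hΦ x₀ c)
      (comap Subtype.val (𝓝 (0 : ℝ))) (𝓝 (D : C(Plane, Plane))) := by
  rw [ContinuousMap.tendsto_iff_forall_isCompact_tendstoUniformlyOn]
  intro K hK
  rw [Metric.tendstoUniformlyOn_iff]
  intro ε hε
  obtain ⟨R, hR0, hR⟩ := hK.isBounded.exists_pos_norm_le
  obtain ⟨η, hη, hη'⟩ := Metric.eventually_nhds_iff.1
    (hD.isLittleO.def (c := ε / (2 * R)) (by positivity))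
  have hev : ∀ᶠ c in 𝓝 (0 : ℝ), c < η / R := gt_mem_nhds (by positivity)
  filter_upwards [hev.comap (Subtype.val : Set.Ioi (0 : ℝ) → ℝ)] with ⟨c, hc⟩ hcη h hh
  have hc0 : 0 < c := hc
  have hcη' : c * R < η := (lt_div_iff₀ hR0).1 hcη
  have hdist : dist (x₀ + c • h) x₀ < η := by
    rw [dist_eq_norm, add_sub_cancel_left, norm_smul, Real.norm_of_nonneg hc0.le]
    exact (mul_le_mul_of_nonneg_left (hR h hh) hc0.le).trans_lt hcη'
  have hbound := hη' hdist
  rw [add_sub_cancel_left, map_smul, norm_smul, Real.norm_of_nonneg hc0.le] at hbound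
  have heq : differenceQuotient hΦ x₀ c h - D h =
      c⁻¹ • (Φ (x₀ + c • h) - Φ x₀ - c • D h) := by
    rw [smul_sub c⁻¹, inv_smul_smul₀ hc0.ne']
    rfl
  rw [dist_comm, dist_eq_norm]
  calc ‖differenceQuotient hΦ x₀ c h - D h‖
      = c⁻¹ * ‖Φ (x₀ + c • h) - Φ x₀ - c • D h‖ := by
        rw [heq, norm_smul, Real.norm_of_nonneg (by positivity)]
    _ ≤ c⁻¹ * (ε / (2 * R) * (c * R)) := by
        gcongr
        refine hbound.trans ?_
        gcongr
        exact hR h hh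
    _ = ε / 2 := by field_simp
    _ < ε := half_lt_self hε

theorem measurable_rescaledIncrement (H : ℝ) (a : Plane) (c : ℝ) :
    Measurable (rescaledIncrement H a c) :=
  measurable_continuousMap_of_measurable_eval fun x ↦
    ((measurable_continuousMap_eval (a + c • x)).sub (measurable_continuousMap_eval a)).div_const _

/-- The law on `C(ℝ², ℝ)` of a continuous version of an elementary field is invariant under
rescaled increments: this is stationarity of increments together with self-similarity. -/
theorem IsElementaryField.map_rescaledIncrement_eq {Ω : Type*} [MeasurableSpace Ω]
    {P : Measure Ω} [IsProbabilityMeasure P] {H α₀ δ : ℝ} (hH : H ∈ Set.Ioo (0 : ℝ) 1)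
    {X : Plane → Ω → ℝ} (hX : IsElementaryField P H α₀ δ X) {F : Ω → C(Plane, ℝ)}
    (hF : Measurable F) (hFX : IsContinuousVersion P X F) (a : Plane) {c : ℝ} (hc : 0 < c) :
    P.map (fun ω ↦ rescaledIncrement H a c (F ω)) = P.map F := by
  refine map_continuousMap_eq_of_finset_map_restrict_eq
    ((measurable_rescaledIncrement H a c).comp hF) hF fun I ↦ ?_
  have hver : IsContinuousVersion P (fun x ω ↦ (X (a + c • x) ω - X a ω) / c ^ H)
      (fun ω ↦ rescaledIncrement H a c (F ω)) := fun x ↦ by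
    filter_upwards [hFX (a + c • x), hFX a] with ω h1 h2
    rw [← h1, ← h2]
    rfl
  exact (map_restrict_eq_of_forall_ae_eq hver I).trans
    ((hX.map_restrict_rescaled_increment_eq hH a hc I).trans
      (map_restrict_eq_of_forall_ae_eq hFX I).symm)

/-! ### Localizability -/

theorem mainTheorem3 {Ω : Type*} [MeasurableSpace Ω] (P : Measure Ω) [IsProbabilityMeasure P]
    (H α₀ δ : ℝ) (hH : H ∈ Set.Ioo (0 : ℝ) 1)
    (hα₀ : α₀ ∈ Set.Ioo (-(Real.pi / 2)) (Real.pi / 2)) (hδ : 0 < δ)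
    (X : Plane → Ω → ℝ) (hX : IsElementaryField P H α₀ δ X)
    (Φ : Plane → Plane) (hΦ : ContDiff ℝ 1 Φ) (x₀ : Plane) :
    IsLocalizableAt P P H (warpedField X Φ) x₀ (fun x ↦ X (fderiv ℝ Φ x₀ x)) := by
  obtain ⟨F, hF, hFX⟩ := hX.exists_continuous_version hH
  have hΦc := hΦ.continuous
  have hD : HasFDerivAt Φ (fderiv ℝ Φ x₀) x₀ :=
    (hΦ.differentiable one_ne_zero x₀).hasFDerivAt
  have hcomp : ∀ φ : C(Plane, Plane), Measurable fun g : C(Plane, ℝ) ↦ g.comp φ := fun φ ↦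
    (ContinuousMap.continuous_precomp φ).measurable
  -- With the same law, the rescaled increments of the field may be replaced by the field itself;
  -- what remains is a family of warpings of one path, which converges for every outcome.
  have hlim : TendstoInDistribution
      (fun (c : Set.Ioi (0 : ℝ)) ω ↦ (F ω).comp (differenceQuotient hΦc x₀ c))
      (comap Subtype.val (𝓝 (0 : ℝ))) (fun ω ↦ (F ω).comp (fderiv ℝ Φ x₀ : C(Plane, Plane)))
      (fun _ ↦ P) P :=
    tendstoInDistribution_of_ae_tendsto (fun c ↦ ((hcomp _).comp hF).aemeasurable)
      ((hcomp _).comp hF).aemeasurable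
      (.of_forall fun ω ↦ ((ContinuousMap.continuous_postcomp (F ω)).tendsto _).comp
        (tendsto_differenceQuotient hΦc hD))
  have hmeas : ∀ c : Set.Ioi (0 : ℝ), Measurable fun ω ↦
      (rescaledIncrement H (Φ x₀) c (F ω)).comp (differenceQuotient hΦc x₀ c) := fun c ↦
    (hcomp _).comp ((measurable_rescaledIncrement H (Φ x₀) c).comp hF)
  have hlaw : ∀ c : Set.Ioi (0 : ℝ),
      P.map (fun ω ↦ (rescaledIncrement H (Φ x₀) c (F ω)).comp (differenceQuotient hΦc x₀ c)) =
        P.map (fun ω ↦ (F ω).comp (differenceQuotient hΦc x₀ c)) := by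
    intro c
    exact (Measure.map_map (hcomp _)
        ((measurable_rescaledIncrement H (Φ x₀) c).comp hF)).symm.trans
      ((congrArg (Measure.map fun g ↦ g.comp (differenceQuotient hΦc x₀ c))
        (hX.map_rescaledIncrement_eq hH hF hFX (Φ x₀) c.2)).trans
          (Measure.map_map (hcomp _) hF))
  refine ⟨hH, fun c ω ↦ (rescaledIncrement H (Φ x₀) c (F ω)).comp (differenceQuotient hΦc x₀ c),
    fun ω ↦ (F ω).comp (fderiv ℝ Φ x₀ : C(Plane, Plane)), fun c h ↦ ?_,
    fun h ↦ hFX (fderiv ℝ Φ x₀ h), ?_⟩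
  · have hc : (c : ℝ) ≠ 0 := ne_of_gt c.2
    filter_upwards [hFX (Φ (x₀ + (c : ℝ) • h)), hFX (Φ x₀)] with ω h1 h2
    have harg : Φ x₀ + (c : ℝ) • differenceQuotient hΦc x₀ c h = Φ (x₀ + (c : ℝ) • h) := by
      change Φ x₀ + (c : ℝ) • ((c : ℝ)⁻¹ • (Φ (x₀ + (c : ℝ) • h) - Φ x₀)) = _
      rw [smul_inv_smul₀ hc, add_sub_cancel]
    change (F ω (Φ x₀ + (c : ℝ) • differenceQuotient hΦc x₀ c h) - F ω (Φ x₀)) / (c : ℝ) ^ H = _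
    rw [harg, h1, h2]
    rfl
  · refine ⟨fun c ↦ (hmeas c).aemeasurable, hlim.aemeasurable_limit, ?_⟩
    refine hlim.tendsto.congr fun c ↦ Subtype.ext (hlaw c).symm
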